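/- **Setting.** Let $S$ be a set (of spectral parameters) and let $a_-,b_+,b_-,c_+,c_-:S\times S\to\mathbb C$ be arbitrary functions. Put $$R(x,y)=\begin{pmatrix}1&0&0&0\\0&b_+(x,y)&c_+(x,y)&0\\0&c_-(x,y)&b_-(x,y)&0\\0&0&0&a_-(x,y)\end{pmatrix}\in\mathrm{End}(\mathbb C^2\otimes\mathbb C^2)$$ in the ordered basis $v_1\otimes v_1,\ v_1\otimes v_2,\ v_2\otimes v_1,\ v_2\otimes v_2$, and let $R_{ij}(x,y)$ denote this operator acting on the tensor factors $i$ (first) and $j$ (second). Assume only that, for all $x,y,z\in S$, unitarity $R_{12}(x,y)R_{21}(y,x)=1$ and the Yang–Baxter equation $R_{12}(x,y)R_{13}(x,z)R_{23}(y,z)=R_{23}(y,z)R_{13}(x,z)R_{12}(x,y)$ hold; no parameterization of the weights is assumed. Let $L\ge 0$ and let $\xi_1,\dots,\xi_L\in S$ satisfy $b_-(\xi_i,\xi_j)\neq0$ for all $i\ne j$. Let $V_1,\dots,V_L$ be copies of $\mathbb C^2$, and let $e^{(ij)}_k$ be the $2\times2$ matrix unit with $1$ in entry $(i,j)$, acting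 on $V_k$. For $\mu\in S$ define operators $A(\mu),B(\mu),C(\mu),D(\mu)$ on $V_1\otimes\cdots\otimes V_L$ as the entries in an auxiliary space $a$ (a further copy of $\mathbb C^2$) of the monodromy matrix $$R_{aL}(\mu,\xi_L)\cdots R_{a1}(\mu,\xi_1)=\begin{pmatrix}A(\mu)&B(\mu)\\C(\mu)&D(\mu)\end{pmatrix}_a .$$ Put $\mathcal F_{i,(i+1)\dots L}=e^{(11)}_i+e^{(22)}_i\,R_{iL}(\xi_i,\xi_L)\cdots R_{i(i+1)}(\xi_i,\xi_{i+1})$ (the identity for $i=L$) and $\mathcal F=\mathcal F_{1\dots L}=\mathcal F_{(L-1),L}\cdots\mathcal F_{2,3\dots L}\,\mathcal F_{1,2\dots L}$. **Claim.** $\mathcal F$ is lower triangular in the lexicographically ordered product basis and invertible, and the twisted operators $\tilde X=\mathcal F X\mathcal F^{-1}$ are given, for every $\mu\in S$, by $$\tilde D(\mu)=\bigotimes_{i=1}^L\begin{pmatrix}b_-(\mu,\xi_i)&0\\0&a_-(\mu,\xi_i)\end{pmatrix}_i,$$ $$\tilde C(\mu)=\sum_{l=1}^Lc_-(\mu,\xi_l)\bigotimes_{i=1}^{l-1}\begin{pmatrix}\frac{b_-(\mu,\xi_i)}{b_-(\xi_l,\xi_i)}&0\\0&a_-(\mu,\xi_i)\end{pmatrix}_i\otimes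 e^{(12)}_l\otimes\bigotimes_{j=l+1}^L\begin{pmatrix}\frac{b_-(\mu,\xi_j)}{b_-(\xi_l,\xi_j)}&0\\0&\frac{a_-(\mu,\xi_j)}{a_-(\xi_l,\xi_j)}\end{pmatrix}_j,$$ $$\tilde B(\mu)=\sum_{l=1}^Lc_+(\mu,\xi_l)\bigotimes_{i=1}^{l-1}\begin{pmatrix}b_-(\mu,\xi_i)&0\\0&\frac{a_-(\mu,\xi_i)a_-(\xi_i,\xi_l)}{b_-(\xi_i,\xi_l)}\end{pmatrix}_i\otimes e^{(21)}_l\otimes\bigotimes_{j=l+1}^L\begin{pmatrix}b_-(\mu,\xi_j)&0\\0&\frac{a_-(\mu,\xi_j)}{b_-(\xi_j,\xi_l)}\end{pmatrix}_j .$$ If moreover $b_-(\xi_i,\mu)\neq0$ for all $i$, then $\tilde D(\mu)$ is invertible and $$\tilde A(\mu)=\bigotimes_{i=1}^L\begin{pmatrix}1&0\\0&\frac1{b_-(\xi_i,\mu)}\end{pmatrix}_i+\tilde B(\mu)\,\tilde D(\mu)^{-1}\,\tilde C(\mu).$$ -/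

import Mathlib

namespace SixVertex

noncomputable section

/-- An operator on a chain of spaces `⨂_{k : ι} ℂ²`, as a matrix in the standard product basis.
The basis vectors are the configurations `ι → Fin 2`; the value `0` is the first basis vector of
the local space `ℂ²` and `1` the second one. -/
abbrev ChainOp (ι : Type*) := Matrix (ι → Fin 2) (ι → Fin 2) ℂ

/-- The tensor product `⨂_k m_k` of one `2 × 2` matrix per space. -/
def tensorOp {ι : Type*} [Fintype ι] (m : ι → Matrix (Fin 2) (Fin 2) ℂ) : ChainOp ι :=
  Matrix.of fun s t => ∏ k, m k (s k) (t k)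

/-- The `2 × 2` matrix `m` acting on the space `i`, and the identity on all other spaces. -/
def siteOp {ι : Type*} [Fintype ι] [DecidableEq ι] (i : ι) (m : Matrix (Fin 2) (Fin 2) ℂ) :
    ChainOp ι :=
  tensorOp (Function.update (fun _ => 1) i m)

/-- The operator `M` on `ℂ² ⊗ ℂ²` acting on the spaces `i` (first factor) and `j` (second factor),
and the identity on all other spaces. It is used for `i ≠ j`. -/
def pairOp {ι : Type*} [Fintype ι] [DecidableEq ι] (i j : ι)
    (M : Matrix (Fin 2 × Fin 2) (Fin 2 × Fin 2) ℂ) : ChainOp ι :=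
  Matrix.of fun s t => if ∀ k, k ≠ i → k ≠ j → s k = t k then M (s i, s j) (t i, t j) else 0

/-- The matrix unit `e^{(11)}`. -/
def e11 : Matrix (Fin 2) (Fin 2) ℂ := !![1, 0; 0, 0]

/-- The matrix unit `e^{(12)}`. -/
def e12 : Matrix (Fin 2) (Fin 2) ℂ := !![0, 1; 0, 0]

/-- The matrix unit `e^{(21)}`. -/
def e21 : Matrix (Fin 2) (Fin 2) ℂ := !![0, 0; 1, 0]

/-- The matrix unit `e^{(22)}`. -/
def e22 : Matrix (Fin 2) (Fin 2) ℂ := !![0, 0; 0, 1]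

/-- Boltzmann weights of a six-vertex model with spectral parameters in an arbitrary set `S`,
normalized so that the weight `a₊` is `1`. No relation between the weights is built in. -/
structure Weights (S : Type*) where
  /-- the weight `a₋` -/
  am : S → S → ℂ
  /-- the weight `b₊` -/
  bp : S → S → ℂ
  /-- the weight `b₋` -/
  bm : S → S → ℂ
  /-- the weight `c₊` -/
  cp : S → S → ℂ
  /-- the weight `c₋` -/
  cm : S → S → ℂ

namespace Weights

variable {S : Type*} (W : Weights S)

/-- The `R`-matrix on `ℂ² ⊗ ℂ²`, in the basis ordered as `(0,0), (0,1), (1,0), (1,1)`. -/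
def R (x y : S) : Matrix (Fin 2 × Fin 2) (Fin 2 × Fin 2) ℂ :=
  Matrix.submatrix
    (!![1, 0, 0, 0;
        0, W.bp x y, W.cp x y, 0;
        0, W.cm x y, W.bm x y, 0;
        0, 0, 0, W.am x y] : Matrix (Fin (2 * 2)) (Fin (2 * 2)) ℂ)
    finProdFinEquiv finProdFinEquiv

/-- `R_{ij}(p_i, p_j)`, where `p_k` is the spectral parameter attached to the space `k`. -/
def Rat {ι : Type*} [Fintype ι] [DecidableEq ι] (p : ι → S) (i j : ι) : ChainOp ι :=
  pairOp i j (W.R (p i) (p j))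

/-- Unitarity: `R₁₂(x,y) R₂₁(y,x) = 1`. -/
def Unitarity : Prop :=
  ∀ p : Fin 2 → S, W.Rat p 0 1 * W.Rat p 1 0 = 1

/-- The Yang-Baxter equation:
`R₁₂(x,y) R₁₃(x,z) R₂₃(y,z) = R₂₃(y,z) R₁₃(x,z) R₁₂(x,y)`. -/
def YangBaxter : Prop :=
  ∀ p : Fin 3 → S,
    W.Rat p 0 1 * W.Rat p 0 2 * W.Rat p 1 2 = W.Rat p 1 2 * W.Rat p 0 2 * W.Rat p 0 1

/-- The left-handed product `R_{i, j₁ … j_n} = R_{i j_n} ⋯ R_{i j₂} R_{i j₁}`. -/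
def Rleft {ι : Type*} [Fintype ι] [DecidableEq ι] (p : ι → S) (i : ι) (js : List ι) : ChainOp ι :=
  (js.map (W.Rat p i)).reverse.prod

variable {L : ℕ}

/-- The monodromy matrix `T_{a,1…L}(μ) = R_{aL}(μ,ξ_L) ⋯ R_{a1}(μ,ξ_1)`.
Space `0` of `Fin (L + 1)` is the auxiliary space `a`, with parameter `μ`, and space `k.succ` is
the quantum space `k : Fin L`, with parameter `ξ k`. -/
def monodromy (ξ : Fin L → S) (μ : S) : ChainOp (Fin (L + 1)) :=
  W.Rleft (Fin.cons μ ξ) 0 ((List.finRange L).map Fin.succ)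

/-- The entry of the monodromy matrix in row `α` and column `β` of the auxiliary space, an operator
on the quantum spaces. -/
def entry (α β : Fin 2) (ξ : Fin L → S) (μ : S) : ChainOp (Fin L) :=
  Matrix.of fun s t => W.monodromy ξ μ (Fin.cons α s) (Fin.cons β t)

/-- The monodromy entry `A_{1…L}(μ)`. -/
def A (ξ : Fin L → S) (μ : S) : ChainOp (Fin L) := W.entry 0 0 ξ μ

/-- The monodromy entry `B_{1…L}(μ)`. -/
def B (ξ : Fin L → S) (μ : S) : ChainOp (Fin L) := W.entry 0 1 ξ μ

/-- The monodromy entry `C_{1…L}(μ)`. -/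
def C (ξ : Fin L → S) (μ : S) : ChainOp (Fin L) := W.entry 1 0 ξ μ

/-- The monodromy entry `D_{1…L}(μ)`. -/
def D (ξ : Fin L → S) (μ : S) : ChainOp (Fin L) := W.entry 1 1 ξ μ

/-- The partial matrix `𝓕_{i,(i+1)…L} = e^{(11)}_i + e^{(22)}_i R_{i,(i+1)…L}`.
For the last site the product over the later sites is empty and this is the identity. -/
def partialF (ξ : Fin L → S) (i : Fin L) : ChainOp (Fin L) :=
  siteOp i e11 + siteOp i e22 * W.Rleft ξ i ((List.finRange L).filter fun j => i < j)

/-- The matrix `𝓕_{1…L} = 𝓕_{(L-1),L} ⋯ 𝓕_{2,3…L} 𝓕_{1,2…L}`. -/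
def F (ξ : Fin L → S) : ChainOp (Fin L) :=
  ((List.finRange L).map (W.partialF ξ)).reverse.prod

/-- The twist `X̃ = 𝓕 X 𝓕⁻¹`. -/
def twist (ξ : Fin L → S) (X : ChainOp (Fin L)) : ChainOp (Fin L) :=
  W.F ξ * X * (W.F ξ)⁻¹

end Weights

end

end SixVertex

/-! Induction on the chain length, splitting off the first site and writing operators as 2 × 2 block
matrices over the remaining chain. The factor `𝓕_{1,2…L}` has blocks `[[1, 0], [C(ξ₁), D(ξ₁)]]`,
where C and D belong to the shorter chain: the row of `R_{1,2…L}` kept by `e^{(22)}` is the lower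
row of a monodromy matrix whose auxiliary space is site 1. So twisting on the full chain is twisting
each block on the tail, then conjugating by `[[1, 0], [C̃(ξ₁), D̃(ξ₁)]]`
(`blocks_twist_mul_twistStep`), whose entries the induction hypothesis makes explicit.

The blocks of A, B, C, D for the full chain are multiples of A, B, C, D for the tail, so each
formula becomes four block identities. Most are exchange relations (`YangBaxter.rtt`) between μ and
ξ₁; the others compare coefficients of elementary tensors and reduce to scalar consequences of
Yang–Baxter (`bm_mul_cm`) and unitarity (`cm_mul_bm`).

The operators A and B need a joint induction. The relation that gives B̃ on the long chain contains
Ã(ξ₁) on the tail, which is eliminated through the Schur complement K = Ã - B̃ D̃⁻¹ C̃, a diagonal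
tensor product. K on the long chain then follows from a purely algebraic block identity
(`block_schur`), whose inputs are the determinant relation `bm_mul_det` and the exchange of K with
C̃ (`twistedSchur_mul_twistedC`). -/

namespace SixVertex

noncomputable section

/-! ### Block decomposition along the first space -/

/-- An operator on `L + 1` spaces as a `2 × 2` block matrix with respect to the first space. -/
def blocks (L : ℕ) : ChainOp (Fin (L + 1)) ≃ₐ[ℂ] Matrix (Fin 2) (Fin 2) (ChainOp (Fin L)) :=
  (Matrix.reindexAlgEquiv ℂ ℂ (Fin.consEquiv fun _ => Fin 2).symm).trans
    (Matrix.compAlgEquiv (Fin 2) (Fin L → Fin 2) ℂ ℂ).symm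

variable {L : ℕ}

theorem blocks_apply (M : ChainOp (Fin (L + 1))) (a b : Fin 2) (u v : Fin L → Fin 2) :
    blocks L M a b u v = M (Fin.cons a u) (Fin.cons b v) := rfl

theorem blocks_tensorOp (m : Fin (L + 1) → Matrix (Fin 2) (Fin 2) ℂ) :
    blocks L (tensorOp m) = Matrix.of fun a b => m 0 a b • tensorOp fun i => m i.succ := by
  ext a b u v
  simp [blocks_apply, tensorOp, Fin.prod_univ_succ]

/-- The operator on the last `L` spaces, acting trivially on the first space. -/
def liftTail (L : ℕ) : ChainOp (Fin L) →+* ChainOp (Fin (L + 1)) :=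
  ((blocks L).symm : _ →+* ChainOp (Fin (L + 1))).comp (Matrix.scalar (Fin 2))

theorem blocks_liftTail (M : ChainOp (Fin L)) : blocks L (liftTail L M) = !![M, 0; 0, M] := by
  simp only [liftTail, RingHom.comp_apply]
  erw [(blocks L).apply_symm_apply]
  ext1 a b
  fin_cases a <;> fin_cases b <;> simp

theorem liftTail_apply_cons (M : ChainOp (Fin L)) (a b : Fin 2) (u v : Fin L → Fin 2) :
    liftTail L M (Fin.cons a u) (Fin.cons b v) = if a = b then M u v else 0 := by
  have h := congrFun (congrFun (congrFun (congrFun (blocks_liftTail M) a) b) u) v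
  rw [blocks_apply] at h
  rw [h]
  fin_cases a <;> fin_cases b <;> simp

theorem chainOp_ext_cons {M N : ChainOp (Fin (L + 1))}
    (h : ∀ a b u v, M (Fin.cons a u) (Fin.cons b v) = N (Fin.cons a u) (Fin.cons b v)) :
    M = N := by
  ext s t
  rw [← Fin.cons_self_tail s, ← Fin.cons_self_tail t]
  exact h _ _ _ _

theorem tensorOp_mul {ι : Type*} [Fintype ι] [DecidableEq ι]
    (m n : ι → Matrix (Fin 2) (Fin 2) ℂ) :
    tensorOp m * tensorOp n = tensorOp fun i => m i * n i := by
  ext s t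
  simp only [tensorOp, Matrix.mul_apply, Matrix.of_apply, ← Finset.prod_mul_distrib]
  rw [Finset.prod_univ_sum, Fintype.piFinset_univ]

theorem tensorOp_one {ι : Type*} [Fintype ι] [DecidableEq ι] :
    tensorOp (fun _ : ι => (1 : Matrix (Fin 2) (Fin 2) ℂ)) = 1 := by
  ext s t
  simp only [tensorOp, Matrix.of_apply, Matrix.one_apply]
  rw [Finset.prod_ite_zero]
  simp [funext_iff]

/-- Two elementary tensors that agree up to a scalar at one site, and agree elsewhere. -/
theorem tensorOp_eq_smul {ι : Type*} [Fintype ι] [DecidableEq ι]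
    {m n : ι → Matrix (Fin 2) (Fin 2) ℂ} (l : ι) (c : ℂ) (hl : m l = c • n l)
    (h : ∀ i, i ≠ l → m i = n i) : tensorOp m = c • tensorOp n := by
  ext s t
  simp only [tensorOp, Matrix.of_apply, Matrix.smul_apply, smul_eq_mul]
  rw [← Finset.mul_prod_erase _ _ (Finset.mem_univ l),
    ← Finset.mul_prod_erase _ (fun k => n k (s k) (t k)) (Finset.mem_univ l), hl,
    Finset.prod_congr rfl fun i hi => by rw [h i (Finset.ne_of_mem_erase hi)]]
  simp [mul_assoc]

theorem liftTail_siteOp (i : Fin L) (m : Matrix (Fin 2) (Fin 2) ℂ) :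
    siteOp i.succ m = liftTail L (siteOp i m) := by
  apply (blocks L).injective
  rw [blocks_liftTail, siteOp, blocks_tensorOp]
  have : (fun k : Fin L => Function.update (fun _ => (1 : Matrix (Fin 2) (Fin 2) ℂ)) i.succ m
      k.succ) = Function.update (fun _ => 1) i m := by
    funext k
    simp [Function.update_apply]
  rw [this]
  have h0 : Function.update (fun _ => (1 : Matrix (Fin 2) (Fin 2) ℂ)) i.succ m 0 = 1 :=
    Function.update_of_ne (Fin.succ_ne_zero i).symm _ _
  ext1 a b
  rw [h0]
  fin_cases a <;> fin_cases b <;> simp [siteOp]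

theorem blocks_siteOp_zero (m : Matrix (Fin 2) (Fin 2) ℂ) :
    blocks L (siteOp 0 m) = Matrix.of fun a b => m a b • 1 := by
  rw [siteOp, blocks_tensorOp]
  simp [tensorOp_one]

theorem liftTail_pairOp (i j : Fin L) (M : Matrix (Fin 2 × Fin 2) (Fin 2 × Fin 2) ℂ) :
    pairOp i.succ j.succ M = liftTail L (pairOp i j M) := by
  refine chainOp_ext_cons fun a b u v => ?_
  rw [liftTail_apply_cons]
  simp only [pairOp, Matrix.of_apply, Fin.cons_succ]
  by_cases hab : a = b
  · simp [hab, Fin.forall_fin_succ]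
  · rw [if_neg, if_neg hab]
    intro h
    exact hab (by simpa using h 0 (Fin.succ_ne_zero _).symm (Fin.succ_ne_zero _).symm)

/-- An operator on a first space and `L` further spaces, acting trivially on a new space inserted
after the first one. -/
def insertSecond (L : ℕ) : ChainOp (Fin (L + 1)) →+* ChainOp (Fin (L + 1 + 1)) :=
  ((blocks (L + 1)).symm : _ →+* ChainOp (Fin (L + 1 + 1))).comp
    ((liftTail L).mapMatrix.comp (blocks L : _ →+* Matrix (Fin 2) (Fin 2) (ChainOp (Fin L))))

theorem blocks_insertSecond (M : ChainOp (Fin (L + 1))) :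
    blocks (L + 1) (insertSecond L M) = (blocks L M).map (liftTail L) := by
  simp only [insertSecond, RingHom.comp_apply]
  erw [(blocks (L + 1)).apply_symm_apply]
  rfl

theorem insertSecond_apply_cons (M : ChainOp (Fin (L + 1))) (a b c d : Fin 2)
    (u v : Fin L → Fin 2) :
    insertSecond L M (Fin.cons a (Fin.cons c u)) (Fin.cons b (Fin.cons d v)) =
      if c = d then M (Fin.cons a u) (Fin.cons b v) else 0 := by
  have h := congrFun (congrFun (congrFun (congrFun (blocks_insertSecond M) a) b)
    (Fin.cons c u)) (Fin.cons d v)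
  rw [blocks_apply] at h
  rw [h, Matrix.map_apply, liftTail_apply_cons, blocks_apply]

theorem insertSecond_pairOp (j : Fin L) (M : Matrix (Fin 2 × Fin 2) (Fin 2 × Fin 2) ℂ) :
    pairOp 0 j.succ.succ M = insertSecond L (pairOp 0 j.succ M) := by
  refine chainOp_ext_cons fun a b s t => ?_
  rw [← Fin.cons_self_tail s, ← Fin.cons_self_tail t, insertSecond_apply_cons]
  generalize s 0 = c, t 0 = d, Fin.tail s = u, Fin.tail t = v
  simp only [pairOp, Matrix.of_apply, Fin.cons_succ, Fin.cons_zero]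
  by_cases hcd : c = d
  · simp [hcd, Fin.forall_fin_succ, Fin.succ_ne_zero]
  · rw [if_neg, if_neg hcd]
    intro h
    exact hcd (h (Fin.succ 0) (Fin.succ_ne_zero _)
      fun h' => (Fin.succ_ne_zero j).symm (Fin.succ_injective _ h'))

theorem blocks_blocks_pairOp_zero_one (M : Matrix (Fin 2 × Fin 2) (Fin 2 × Fin 2) ℂ)
    (a b : Fin 2) :
    blocks L (blocks (L + 1) (pairOp 0 (Fin.succ 0) M) a b) =
      Matrix.of fun c d => M (a, c) (b, d) • (1 : ChainOp (Fin L)) := by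
  ext c d u v
  simp only [blocks_apply, pairOp, Matrix.of_apply, Matrix.smul_apply, Matrix.one_apply,
    Fin.forall_fin_succ, Fin.cons_zero, Fin.cons_succ]
  by_cases h : u = v
  · simp [h]
  · rw [if_neg h, smul_zero, if_neg]
    intro h'
    exact h (funext fun i => h'.2.2 i (Fin.succ_ne_zero _)
      fun h'' => Fin.succ_ne_zero i (Fin.succ_injective _ h''))

/-! ### Splitting the first site off the monodromy matrix and the twist -/

namespace Weights

variable {S : Type*} (W : Weights S)

theorem R_apply (x y : S) (a b c d : Fin 2) :
    W.R x y (a, b) (c, d) =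
      if a = c ∧ b = d then
        if a = 0 then if b = 0 then 1 else W.bp x y
        else if b = 0 then W.bm x y else W.am x y
      else if a = 0 ∧ b = 1 ∧ c = 1 ∧ d = 0 then W.cp x y
      else if a = 1 ∧ b = 0 ∧ c = 0 ∧ d = 1 then W.cm x y else 0 := by
  fin_cases a <;> fin_cases b <;> fin_cases c <;> fin_cases d <;> rfl

/-- `R_{a1}` is the rightmost factor of the monodromy matrix, and the others do not touch the first
quantum site. -/
theorem monodromy_succ (ξ : Fin (L + 1) → S) (μ : S) :
    W.monodromy ξ μ =
      insertSecond L (W.monodromy (Fin.tail ξ) μ) *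
        pairOp 0 (Fin.succ 0) (W.R μ (ξ 0)) := by
  have h : ∀ js : List (Fin L), W.Rleft (Fin.cons μ ξ : Fin (L + 1 + 1) → S) 0
      ((js.map Fin.succ).map Fin.succ) =
        insertSecond L (W.Rleft (Fin.cons μ (Fin.tail ξ) : Fin (L + 1) → S) 0
          (js.map Fin.succ)) := by
    intro js
    simp only [Rleft, map_list_prod, List.map_reverse, List.map_map]
    congr 3
    funext j
    exact insertSecond_pairOp j _
  rw [monodromy, monodromy, ← h, List.finRange_succ]
  simp [Rleft, Rat]

theorem entry_eq_blocks (a b : Fin 2) (ξ : Fin L → S) (μ : S) :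
    W.entry a b ξ μ = blocks L (W.monodromy ξ μ) a b := rfl

theorem blocks_entry (a b : Fin 2) (ξ : Fin (L + 1) → S) (μ : S) :
    blocks L (W.entry a b ξ μ) = Matrix.of fun c d =>
      ∑ k, W.R μ (ξ 0) (k, c) (b, d) • W.entry a k (Fin.tail ξ) μ := by
  rw [entry_eq_blocks, monodromy_succ, map_mul, Matrix.mul_apply]
  simp only [map_sum, map_mul, blocks_blocks_pairOp_zero_one, blocks_insertSecond, Matrix.map_apply,
    blocks_liftTail]
  ext1 c d
  simp only [Matrix.sum_apply, Matrix.of_apply]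
  refine Finset.sum_congr rfl fun k _ => ?_
  rw [Matrix.mul_apply, entry_eq_blocks]
  fin_cases c <;> simp

theorem blocks_D (ξ : Fin (L + 1) → S) (μ : S) :
    blocks L (W.D ξ μ) =
      !![W.bm μ (ξ 0) • W.D (Fin.tail ξ) μ, 0;
         W.cp μ (ξ 0) • W.C (Fin.tail ξ) μ, W.am μ (ξ 0) • W.D (Fin.tail ξ) μ] := by
  rw [D, blocks_entry]
  ext1 a b
  fin_cases a <;> fin_cases b <;> simp [R_apply, C, D]

theorem blocks_C (ξ : Fin (L + 1) → S) (μ : S) :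
    blocks L (W.C ξ μ) =
      !![W.C (Fin.tail ξ) μ, W.cm μ (ξ 0) • W.D (Fin.tail ξ) μ;
         0, W.bp μ (ξ 0) • W.C (Fin.tail ξ) μ] := by
  rw [C, blocks_entry]
  ext1 a b
  fin_cases a <;> fin_cases b <;> simp [R_apply, C, D]

theorem blocks_B (ξ : Fin (L + 1) → S) (μ : S) :
    blocks L (W.B ξ μ) =
      !![W.bm μ (ξ 0) • W.B (Fin.tail ξ) μ, 0;
         W.cp μ (ξ 0) • W.A (Fin.tail ξ) μ, W.am μ (ξ 0) • W.B (Fin.tail ξ) μ] := by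
  rw [B, blocks_entry]
  ext1 a b
  fin_cases a <;> fin_cases b <;> simp [R_apply, A, B]

theorem blocks_A (ξ : Fin (L + 1) → S) (μ : S) :
    blocks L (W.A ξ μ) =
      !![W.A (Fin.tail ξ) μ, W.cm μ (ξ 0) • W.B (Fin.tail ξ) μ;
         0, W.bp μ (ξ 0) • W.A (Fin.tail ξ) μ] := by
  rw [A, blocks_entry]
  ext1 a b
  fin_cases a <;> fin_cases b <;> simp [R_apply, A, B]

theorem partialF_succ (ξ : Fin (L + 1) → S) (i : Fin L) :
    W.partialF ξ i.succ = liftTail L (W.partialF (Fin.tail ξ) i) := by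
  have h : ∀ js : List (Fin L), W.Rleft ξ i.succ (js.map Fin.succ) =
      liftTail L (W.Rleft (Fin.tail ξ) i js) := by
    intro js
    simp only [Rleft, map_list_prod, List.map_reverse, List.map_map]
    congr 3
    funext j
    exact liftTail_pairOp i j _
  have hf : ((List.finRange (L + 1)).filter fun j => i.succ < j) =
      ((List.finRange L).filter fun j => i < j).map Fin.succ := by
    rw [List.finRange_succ, List.filter_cons_of_neg (by simp), List.filter_map]
    congr 2
    funext j
    simp
  simp only [partialF, hf, h, liftTail_siteOp, map_add, map_mul]

theorem F_succ (ξ : Fin (L + 1) → S) :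
    W.F ξ = liftTail L (W.F (Fin.tail ξ)) * W.partialF ξ 0 := by
  simp only [F, List.finRange_succ, List.map_cons, List.reverse_cons, List.prod_append,
    List.prod_singleton, map_list_prod, List.map_reverse, List.map_map]
  congr 4
  funext i
  exact W.partialF_succ ξ i

/-- With the first site as auxiliary space, the product of R-matrices in `partialF ξ 0` is the
monodromy matrix of the tail at parameter `ξ 0`; `e22` keeps its lower row and `e11` supplies the
upper one. -/
theorem blocks_partialF_zero (ξ : Fin (L + 1) → S) :
    blocks L (W.partialF ξ 0) =
      !![1, 0; W.C (Fin.tail ξ) (ξ 0), W.D (Fin.tail ξ) (ξ 0)] := by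
  have h : W.Rleft ξ 0 ((List.finRange (L + 1)).filter fun j => 0 < j) =
      W.monodromy (Fin.tail ξ) (ξ 0) := by
    rw [monodromy, Fin.cons_self_tail, List.finRange_succ, List.filter_cons_of_neg (by simp),
      List.filter_eq_self.2 (by simp [Fin.pos_iff_ne_zero])]
  have h' : blocks L (W.monodromy (Fin.tail ξ) (ξ 0)) = Matrix.of fun a b =>
    W.entry a b (Fin.tail ξ) (ξ 0) := rfl
  rw [partialF, h, map_add, map_mul, blocks_siteOp_zero, blocks_siteOp_zero, h']
  ext1 a b
  fin_cases a <;> fin_cases b <;> simp [Matrix.mul_apply, e11, e22, C, D]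

theorem F_zero (ξ : Fin 0 → S) : W.F ξ = 1 := by
  simp [F]

/-! ### Yang–Baxter and unitarity in components, exchange relations -/

theorem sum_cons_fin_two {n : ℕ} (f : (Fin (n + 1) → Fin 2) → ℂ) :
    ∑ s, f s = ∑ a, ∑ s : Fin n → Fin 2, f (Fin.cons a s) := by
  rw [← Fintype.sum_prod_type']
  exact ((Fin.consEquiv fun _ => Fin 2).sum_comp f).symm

theorem sum_fin_two_fin_two (f : (Fin 2 → Fin 2) → ℂ) : ∑ s, f s = ∑ a, ∑ b, f ![a, b] := by
  simp only [sum_cons_fin_two, Fintype.sum_unique]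
  congr! 5

theorem sum_fin_three_fin_two (f : (Fin 3 → Fin 2) → ℂ) :
    ∑ s, f s = ∑ a, ∑ b, ∑ c, f ![a, b, c] := by
  simp only [sum_cons_fin_two, Fintype.sum_unique]
  congr! 8

variable {W} in
theorem Unitarity.sum_eq (hU : W.Unitarity) (x y : S) (a b c d : Fin 2) :
    ∑ i, ∑ j, W.R x y (a, b) (i, j) * W.R y x (j, i) (d, c) =
      if a = c ∧ b = d then 1 else 0 := by
  have h := congrFun (congrFun (hU ![x, y]) ![a, b]) ![c, d]
  simpa [Matrix.mul_apply, sum_fin_two_fin_two, Rat, pairOp, Matrix.one_apply,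
    Fin.forall_fin_succ, funext_iff] using h

variable {W} in
theorem YangBaxter.sum_eq (hYB : W.YangBaxter) (x y z : S) (a b c a' b' c' : Fin 2) :
    ∑ i, ∑ j, ∑ k, W.R x y (a, b) (i, j) * W.R x z (i, c) (a', k) * W.R y z (j, k) (b', c') =
    ∑ i, ∑ j, ∑ k, W.R y z (b, c) (j, k) * W.R x z (a, k) (i, c') * W.R x y (i, j) (a', b') := by
  have h := congrFun (congrFun (hYB ![x, y, z]) ![a, b, c]) ![a', b', c']
  simp [Matrix.mul_apply, sum_fin_three_fin_two, Rat, pairOp, Fin.forall_fin_succ] at h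
  fin_cases c <;> fin_cases c' <;> fin_cases a <;> fin_cases a' <;> simp at h ⊢ <;>
    linear_combination h

variable {W} in
/-- The `RTT` relations between the entries of the monodromy matrix. -/
theorem YangBaxter.rtt (hYB : W.YangBaxter) (μ ν : S) : ∀ {L : ℕ} (ξ : Fin L → S)
    (a b c d : Fin 2),
    ∑ i, ∑ j, W.R μ ν (a, b) (i, j) • (W.entry i c ξ μ * W.entry j d ξ ν) =
      ∑ i, ∑ j, W.R μ ν (i, j) (c, d) • (W.entry b j ξ ν * W.entry a i ξ μ)
  | 0, ξ, a, b, c, d => by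
    have h : ∀ (i j : Fin 2) (κ : S), W.entry i j ξ κ = if i = j then 1 else 0 := by
      intro i j κ
      ext u v
      rw [Subsingleton.elim u v]
      split_ifs with hij <;> simp [entry, monodromy, Rleft, Matrix.one_apply, hij]
    simp only [h]
    fin_cases a <;> fin_cases b <;> fin_cases c <;> fin_cases d <;> simp
  | L + 1, ξ, a, b, c, d => by
    apply (blocks L).injective
    ext1 s t
    have ih := hYB.rtt μ ν (Fin.tail ξ) a b
    have yb := fun i j => hYB.sum_eq μ ν (ξ 0) i j s c d t
    simp only [map_add, map_smul, map_mul, blocks_entry, Matrix.add_apply, Matrix.smul_apply,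
      Matrix.mul_apply, Matrix.of_apply, Fin.sum_univ_two, add_mul, mul_add, smul_mul_smul_comm]
      at ih yb ⊢
    -- The hypothesis `ih` exchanges the tail entries, with the local weights at the first site as
    -- coefficients; the scalar equation `yb` then exchanges those weights.
    linear_combination (norm := module)
      (W.R μ (ξ 0) (0, s) (c, 0) * W.R ν (ξ 0) (0, 0) (d, t)
        + W.R μ (ξ 0) (0, s) (c, 1) * W.R ν (ξ 0) (0, 1) (d, t)) • ih 0 0
      + (W.R μ (ξ 0) (0, s) (c, 0) * W.R ν (ξ 0) (1, 0) (d, t)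
        + W.R μ (ξ 0) (0, s) (c, 1) * W.R ν (ξ 0) (1, 1) (d, t)) • ih 0 1
      + (W.R μ (ξ 0) (1, s) (c, 0) * W.R ν (ξ 0) (0, 0) (d, t)
        + W.R μ (ξ 0) (1, s) (c, 1) * W.R ν (ξ 0) (0, 1) (d, t)) • ih 1 0
      + (W.R μ (ξ 0) (1, s) (c, 0) * W.R ν (ξ 0) (1, 0) (d, t)
        + W.R μ (ξ 0) (1, s) (c, 1) * W.R ν (ξ 0) (1, 1) (d, t)) • ih 1 1
      + yb 0 0 • (W.entry b 0 (Fin.tail ξ) ν * W.entry a 0 (Fin.tail ξ) μ)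
      + yb 0 1 • (W.entry b 1 (Fin.tail ξ) ν * W.entry a 0 (Fin.tail ξ) μ)
      + yb 1 0 • (W.entry b 0 (Fin.tail ξ) ν * W.entry a 1 (Fin.tail ξ) μ)
      + yb 1 1 • (W.entry b 1 (Fin.tail ξ) ν * W.entry a 1 (Fin.tail ξ) μ)

section Relations

variable {W} (hYB : W.YangBaxter) (ξ : Fin L → S) (μ ν : S)
include hYB

theorem YangBaxter.C_mul_C :
    W.am μ ν • (W.C ξ μ * W.C ξ ν) = W.C ξ ν * W.C ξ μ := by
  simpa [R_apply, C] using hYB.rtt μ ν ξ 1 1 0 0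

theorem YangBaxter.D_mul_C :
    W.am μ ν • (W.D ξ μ * W.C ξ ν) =
      W.bm μ ν • (W.C ξ ν * W.D ξ μ) + W.cp μ ν • (W.D ξ ν * W.C ξ μ) := by
  have h := hYB.rtt μ ν ξ 1 1 1 0
  simp [R_apply] at h
  rw [C, C, D, D, h, add_comm]

theorem YangBaxter.C_mul_D :
    W.am μ ν • (W.C ξ μ * W.D ξ ν) =
      W.cm μ ν • (W.C ξ ν * W.D ξ μ) + W.bp μ ν • (W.D ξ ν * W.C ξ μ) := by
  have h := hYB.rtt μ ν ξ 1 1 0 1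
  simp [R_apply] at h
  rw [C, C, D, D, h, add_comm]

theorem YangBaxter.D_mul_B :
    W.am μ ν • (W.D ξ ν * W.B ξ μ) =
      W.bp μ ν • (W.B ξ μ * W.D ξ ν) + W.cp μ ν • (W.D ξ μ * W.B ξ ν) := by
  have h := hYB.rtt μ ν ξ 0 1 1 1
  simp [R_apply] at h
  rw [B, B, D, D, ← h]

theorem YangBaxter.B_mul_C :
    W.bp μ ν • (W.B ξ μ * W.C ξ ν) + W.cp μ ν • (W.D ξ μ * W.A ξ ν) =
      W.bm μ ν • (W.C ξ ν * W.B ξ μ) + W.cp μ ν • (W.D ξ ν * W.A ξ μ) := by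
  have h := hYB.rtt μ ν ξ 0 1 1 0
  simp [R_apply] at h
  rw [A, A, B, C, D, D, h, add_comm]

end Relations

/-! ### Scalar identities between the weights -/

theorem YangBaxter.bm_mul_cm {W : Weights S} (hYB : W.YangBaxter) (x y z : S) :
    W.bm x z * W.cm x y - W.cm x z * W.cp y z * W.bm x y = W.cm x y * W.bm y z := by
  have h1 := hYB.sum_eq x y z 1 0 0 0 1 0
  simp [R_apply] at h1
  linear_combination -h1

section Unitarity

variable {W} (hU : W.Unitarity) (x y : S)
include hU

theorem Unitarity.am_mul_am : W.am x y * W.am y x = 1 := by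
  simpa [R_apply] using hU.sum_eq x y 1 1 1 1

theorem Unitarity.am_ne_zero : W.am x y ≠ 0 := left_ne_zero_of_mul_eq_one (hU.am_mul_am x y)

/-- Cramer's rule for the central 2 × 2 block of R, whose inverse is given by unitarity. It makes
the nonvanishing of `b₋` symmetric in its arguments. -/
theorem Unitarity.bm_mul_det :
    W.bm y x * (W.bp x y * W.bm x y - W.cp x y * W.cm x y) = W.bm x y := by
  have h1 := hU.sum_eq x y 0 1 0 1
  have h2 := hU.sum_eq x y 1 0 0 1
  simp [R_apply] at h1 h2
  linear_combination W.bm x y * h1 - W.cp x y * h2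

theorem Unitarity.cm_mul_bm : W.cm x y * W.bm y x = - (W.cp y x * W.bm x y) := by
  have h := hU.sum_eq x y 1 0 0 1
  simp [R_apply] at h
  linear_combination h

theorem Unitarity.bm_ne_zero {x y : S} (h : W.bm x y ≠ 0) : W.bm y x ≠ 0 := by
  intro h0
  apply h
  rw [← hU.bm_mul_det x y, h0, zero_mul]

end Unitarity

end Weights

/-! ### Algebra and block form of the explicit twisted operators -/

theorem tensorOp_diag {ι : Type*} [Fintype ι] [DecidableEq ι] (p q : ι → ℂ) :
    tensorOp (fun i => !![p i, 0; 0, q i]) =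
      Matrix.diagonal fun s => ∏ i, if s i = 0 then p i else q i := by
  have h : ∀ i, !![p i, 0; 0, q i] = Matrix.diagonal fun a => if a = 0 then p i else q i := by
    intro i
    ext a b
    fin_cases a <;> fin_cases b <;> simp
  rw [funext h]
  ext s t
  simp only [tensorOp, Matrix.of_apply, Matrix.diagonal_apply]
  rw [Finset.prod_ite_zero]
  simp [funext_iff]

theorem tensorOp_diag_commute {ι : Type*} [Fintype ι] [DecidableEq ι] (p q p' q' : ι → ℂ) :
    tensorOp (fun i => !![p i, 0; 0, q i]) * tensorOp (fun i => !![p' i, 0; 0, q' i]) =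
      tensorOp (fun i => !![p' i, 0; 0, q' i]) * tensorOp (fun i => !![p i, 0; 0, q i]) := by
  simp only [tensorOp_diag, Matrix.diagonal_mul_diagonal, mul_comm]

theorem isUnit_tensorOp_diag {ι : Type*} [Fintype ι] [DecidableEq ι] {p q : ι → ℂ}
    (hp : ∀ i, p i ≠ 0) (hq : ∀ i, q i ≠ 0) :
    IsUnit (tensorOp fun i => !![p i, 0; 0, q i]) := by
  rw [tensorOp_diag, Matrix.isUnit_diagonal, Pi.isUnit_iff]
  intro s
  rw [isUnit_iff_ne_zero, Finset.prod_ne_zero_iff]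
  intro i _
  split_ifs
  exacts [hp i, hq i]

namespace Weights

variable {S : Type*} (W : Weights S)

/-- The claimed form of the twisted operator `D`. -/
def twistedD (ξ : Fin L → S) (μ : S) : ChainOp (Fin L) :=
  tensorOp fun i => !![W.bm μ (ξ i), 0; 0, W.am μ (ξ i)]

/-- The elementary tensor at site `l` in the twisted operator `C`. -/
def twistedCTerm (ξ : Fin L → S) (μ : S) (l : Fin L) : ChainOp (Fin L) :=
  tensorOp fun i =>
    if i < l then
      !![W.bm μ (ξ i) / W.bm (ξ l) (ξ i), 0; 0, W.am μ (ξ i)]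
    else if i = l then e12
    else
      !![W.bm μ (ξ i) / W.bm (ξ l) (ξ i), 0; 0, W.am μ (ξ i) / W.am (ξ l) (ξ i)]

/-- The claimed form of the twisted operator `C`. -/
def twistedC (ξ : Fin L → S) (μ : S) : ChainOp (Fin L) :=
  ∑ l, W.cm μ (ξ l) • W.twistedCTerm ξ μ l

/-- The elementary tensor at site `l` in the twisted operator `B`. -/
def twistedBTerm (ξ : Fin L → S) (μ : S) (l : Fin L) : ChainOp (Fin L) :=
  tensorOp fun i =>
    if i < l then
      !![W.bm μ (ξ i), 0; 0, W.am μ (ξ i) * W.am (ξ i) (ξ l) / W.bm (ξ i) (ξ l)]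
    else if i = l then e21
    else
      !![W.bm μ (ξ i), 0; 0, W.am μ (ξ i) / W.bm (ξ i) (ξ l)]

/-- The claimed form of the twisted operator `B`. -/
def twistedB (ξ : Fin L → S) (μ : S) : ChainOp (Fin L) :=
  ∑ l, W.cp μ (ξ l) • W.twistedBTerm ξ μ l

/-- The claimed form of the twisted operator `A - B D⁻¹ C`. -/
def twistedSchur (ξ : Fin L → S) (μ : S) : ChainOp (Fin L) :=
  tensorOp fun i => !![1, 0; 0, 1 / W.bm (ξ i) μ]

/-- The ratio of the twisted operators `D` at two spectral parameters. -/
def twistedDRatio (ξ : Fin L → S) (μ ν : S) : ChainOp (Fin L) :=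
  tensorOp fun i =>
    !![W.bm μ (ξ i) / W.bm ν (ξ i), 0; 0, W.am μ (ξ i) / W.am ν (ξ i)]

section Terms

variable {W} (ξ : Fin L → S) {μ ν : S}

theorem twistedDRatio_mul_twistedD (hU : W.Unitarity) (hν : ∀ i, W.bm ν (ξ i) ≠ 0) :
    W.twistedDRatio ξ μ ν * W.twistedD ξ ν = W.twistedD ξ μ := by
  rw [twistedDRatio, twistedD, twistedD, tensorOp_mul]
  congr 1
  funext i
  simp [div_mul_cancel₀ _ (hν i), div_mul_cancel₀ _ (hU.am_ne_zero ν (ξ i))]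

theorem twistedDRatio_mul_twistedCTerm (hU : W.Unitarity) (hν : ∀ i, W.bm ν (ξ i) ≠ 0)
    (l : Fin L) :
    W.twistedDRatio ξ μ ν * W.twistedCTerm ξ ν l =
      (W.bm μ (ξ l) / W.bm ν (ξ l)) • W.twistedCTerm ξ μ l := by
  rw [twistedDRatio, twistedCTerm, twistedCTerm, tensorOp_mul]
  refine tensorOp_eq_smul l _ (by simp [e12]) fun i hi => ?_
  have h1 := div_mul_div_cancel₀ (a := W.bm μ (ξ i)) (c := W.bm (ξ l) (ξ i)) (hν i)
  have h2 := div_mul_div_cancel₀ (a := W.am μ (ξ i)) (c := W.am (ξ l) (ξ i))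
    (hU.am_ne_zero ν (ξ i))
  have h3 := div_mul_cancel₀ (W.am μ (ξ i)) (hU.am_ne_zero ν (ξ i))
  split_ifs <;> simp [h1, h2, h3]

theorem twistedDRatio_mul_twistedC (hU : W.Unitarity) (hν : ∀ i, W.bm ν (ξ i) ≠ 0) :
    W.twistedDRatio ξ μ ν * W.twistedC ξ ν =
      ∑ l, (W.cm ν (ξ l) * (W.bm μ (ξ l) / W.bm ν (ξ l))) • W.twistedCTerm ξ μ l := by
  simp only [twistedC, Finset.mul_sum, mul_smul_comm, twistedDRatio_mul_twistedCTerm ξ hU hν,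
    smul_smul]

/-- The diagonal factors commute, so only site `l` contributes: `e21` exchanges the two eigenvalues
of `D̃` there. -/
theorem twistedD_mul_twistedBTerm (hν : ∀ i, W.bm ν (ξ i) ≠ 0) (l : Fin L) :
    W.twistedD ξ ν * W.twistedBTerm ξ μ l =
      (W.am ν (ξ l) / W.bm ν (ξ l)) • (W.twistedBTerm ξ μ l * W.twistedD ξ ν) := by
  rw [twistedD, twistedBTerm, tensorOp_mul, tensorOp_mul]
  refine tensorOp_eq_smul l _ ?_ fun i hi => ?_
  · simp [e21, div_mul_cancel₀ _ (hν l)]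
  · split_ifs <;> simp [mul_comm]

theorem twistedCTerm_mul_twistedSchur (l : Fin L) :
    W.twistedCTerm ξ ν l * W.twistedSchur ξ μ =
      (1 / W.bm (ξ l) μ) • (W.twistedSchur ξ μ * W.twistedCTerm ξ ν l) := by
  rw [twistedSchur, twistedCTerm, tensorOp_mul, tensorOp_mul]
  refine tensorOp_eq_smul l _ ?_ fun i hi => ?_
  · ext a b
    fin_cases a <;> fin_cases b <;> simp [e12]
  · split_ifs <;> simp [mul_comm]

theorem twistedD_commute_twistedD :
    W.twistedD ξ μ * W.twistedD ξ ν = W.twistedD ξ ν * W.twistedD ξ μ :=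
  tensorOp_diag_commute _ _ _ _

theorem twistedD_commute_twistedSchur :
    W.twistedD ξ ν * W.twistedSchur ξ μ = W.twistedSchur ξ μ * W.twistedD ξ ν :=
  tensorOp_diag_commute _ _ _ _

theorem isUnit_twistedD (hU : W.Unitarity) (hμ : ∀ i, W.bm μ (ξ i) ≠ 0) :
    IsUnit (W.twistedD ξ μ) :=
  isUnit_tensorOp_diag hμ fun i => hU.am_ne_zero μ (ξ i)

end Terms

section Blocks

variable (ξ : Fin (L + 1) → S) (μ : S)

theorem blocks_twistedD :
    blocks L (W.twistedD ξ μ) =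
      !![W.bm μ (ξ 0) • W.twistedD (Fin.tail ξ) μ, 0;
         0, W.am μ (ξ 0) • W.twistedD (Fin.tail ξ) μ] := by
  rw [twistedD, blocks_tensorOp]
  ext1 a b
  fin_cases a <;> fin_cases b <;> simp [twistedD, Fin.tail]

theorem blocks_twistedSchur :
    blocks L (W.twistedSchur ξ μ) =
      !![W.twistedSchur (Fin.tail ξ) μ, 0;
         0, (1 / W.bm (ξ 0) μ) • W.twistedSchur (Fin.tail ξ) μ] := by
  rw [twistedSchur, blocks_tensorOp]
  ext1 a b
  fin_cases a <;> fin_cases b <;> simp [twistedSchur, Fin.tail]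

/-- The term flipping the first site gives the off-diagonal block; the terms flipping a later site
give the diagonal blocks. -/
theorem blocks_twistedC :
    blocks L (W.twistedC ξ μ) =
      !![∑ l, (W.cm μ (Fin.tail ξ l) * (W.bm μ (ξ 0) / W.bm (Fin.tail ξ l) (ξ 0))) •
            W.twistedCTerm (Fin.tail ξ) μ l,
          W.cm μ (ξ 0) • W.twistedDRatio (Fin.tail ξ) μ (ξ 0);
         0, W.am μ (ξ 0) • W.twistedC (Fin.tail ξ) μ] := by
  have h0 : blocks L (W.twistedCTerm ξ μ 0) =
      !![0, W.twistedDRatio (Fin.tail ξ) μ (ξ 0); 0, 0] := by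
    rw [twistedCTerm, blocks_tensorOp]
    ext1 a b
    fin_cases a <;> fin_cases b <;> simp [e12, twistedDRatio, Fin.tail, Fin.succ_ne_zero]
  have hs : ∀ l : Fin L, blocks L (W.twistedCTerm ξ μ l.succ) =
      !![(W.bm μ (ξ 0) / W.bm (Fin.tail ξ l) (ξ 0)) • W.twistedCTerm (Fin.tail ξ) μ l, 0;
         0, W.am μ (ξ 0) • W.twistedCTerm (Fin.tail ξ) μ l] := by
    intro l
    rw [twistedCTerm, blocks_tensorOp]
    ext1 a b
    fin_cases a <;> fin_cases b <;> simp [twistedCTerm, Fin.tail]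
  rw [twistedC, Fin.sum_univ_succ]
  simp only [map_add, map_sum, map_smul, h0, hs]
  ext1 a b
  fin_cases a <;> fin_cases b <;>
    simp [Matrix.sum_apply, twistedC, Finset.smul_sum, smul_smul, Fin.tail, mul_comm]

/-- The term flipping the first site factors as `D̃(μ)` times the Schur complement at `ξ 0`, which
is how that complement enters the recursion for `B̃`. -/
theorem blocks_twistedB :
    blocks L (W.twistedB ξ μ) =
      !![W.bm μ (ξ 0) • W.twistedB (Fin.tail ξ) μ, 0;
          W.cp μ (ξ 0) • (W.twistedD (Fin.tail ξ) μ * W.twistedSchur (Fin.tail ξ) (ξ 0)),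
          W.am μ (ξ 0) • ∑ l, (W.cp μ (Fin.tail ξ l) *
            (W.am (ξ 0) (Fin.tail ξ l) / W.bm (ξ 0) (Fin.tail ξ l))) •
              W.twistedBTerm (Fin.tail ξ) μ l] := by
  have h0 : blocks L (W.twistedBTerm ξ μ 0) =
      !![0, 0; W.twistedD (Fin.tail ξ) μ * W.twistedSchur (Fin.tail ξ) (ξ 0), 0] := by
    rw [twistedBTerm, blocks_tensorOp, twistedD, twistedSchur, tensorOp_mul]
    ext1 a b
    fin_cases a <;> fin_cases b <;>
      simp [e21, Fin.tail, Fin.succ_ne_zero, div_eq_mul_inv]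
  have hs : ∀ l : Fin L, blocks L (W.twistedBTerm ξ μ l.succ) =
      !![W.bm μ (ξ 0) • W.twistedBTerm (Fin.tail ξ) μ l, 0;
         0, (W.am μ (ξ 0) * (W.am (ξ 0) (Fin.tail ξ l) / W.bm (ξ 0) (Fin.tail ξ l))) •
            W.twistedBTerm (Fin.tail ξ) μ l] := by
    intro l
    rw [twistedBTerm, blocks_tensorOp]
    ext1 a b
    fin_cases a <;> fin_cases b <;> simp [twistedBTerm, Fin.tail, mul_div_assoc]
  rw [twistedB, Fin.sum_univ_succ]
  simp only [map_add, map_sum, map_smul, h0, hs]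
  ext1 a b
  fin_cases a <;> fin_cases b <;>
    simp [Matrix.sum_apply, twistedB, Finset.smul_sum, smul_smul, Fin.tail, mul_comm,
      mul_assoc]

end Blocks

/-! ### The twist as conjugation -/

section Twist

variable {W} {ξ : Fin L → S}

theorem twist_mul_F (hF : IsUnit (W.F ξ)) (X : ChainOp (Fin L)) :
    W.twist ξ X * W.F ξ = W.F ξ * X := by
  rw [twist, mul_assoc, Matrix.nonsing_inv_mul _ ((Matrix.isUnit_iff_isUnit_det _).1 hF), mul_one]

theorem twist_mul (hF : IsUnit (W.F ξ)) (X Y : ChainOp (Fin L)) :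
    W.twist ξ (X * Y) = W.twist ξ X * W.twist ξ Y := by
  refine hF.mul_right_cancel ?_
  rw [mul_assoc, twist_mul_F hF, twist_mul_F hF, ← mul_assoc, ← mul_assoc, twist_mul_F hF]

theorem twist_add (X Y : ChainOp (Fin L)) :
    W.twist ξ (X + Y) = W.twist ξ X + W.twist ξ Y := by
  simp only [twist, mul_add, add_mul]

theorem twist_smul (c : ℂ) (X : ChainOp (Fin L)) :
    W.twist ξ (c • X) = c • W.twist ξ X := by
  simp only [twist, mul_smul_comm, smul_mul_assoc]

theorem twist_zero : W.twist ξ 0 = 0 := by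
  simp only [twist, mul_zero, zero_mul]

end Twist

end Weights

/-! ### Block identities over a noncommutative algebra -/

section Schur

variable {A : Type*} [Ring A] [Algebra ℂ A] {am bp bm bm' cp cm : ℂ}

/-- Solution of a triangular linear system of `2 × 2` block matrices. -/
theorem block_system (ham : am ≠ 0) (hbm : bm ≠ 0) {C D e : A} (he : D * e = C) :
    !![bm • D, 0; cp • C, am • D] *
        !![(1 / bm) • e, (cm / bm) • 1;
          (-(cp / (am * bm))) • (e * e), (bp / am - cp * cm / (am * bm)) • e] =
      !![C, cm • D; 0, bp • C] := by
  have he' : D * (e * e) = C * e := by rw [← mul_assoc, he]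
  rw [Matrix.mul_fin_two]
  ext1 a b
  fin_cases a <;> fin_cases b <;>
    simp only [Fin.zero_eta, Fin.mk_one, Matrix.of_apply, Matrix.cons_val', Matrix.cons_val_zero,
      Matrix.cons_val_one, Matrix.cons_val_fin_one, smul_mul_smul_comm, mul_one, zero_mul, he, he']
  all_goals
    match_scalars
    field_simp
    try ring

/-- Conjugation of a block Schur complement by a triangular block matrix. -/
theorem block_schur (ham : am ≠ 0) (hbm : bm ≠ 0) (hbm' : bm' ≠ 0)
    (hΔ : bm' * (bp * bm - cp * cm) = bm) {k b c d e : A} (hdk : d * k = k * d)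
    (hK : (1 / bm') • (k * c) = c * k - (cp / bm) • (d * (k * e))) :
    !![1, 0; c, d] * !![k + b * e, cm • b; 0, bp • (k + b * e)] =
      !![k, 0; 0, (1 / bm') • k] * !![1, 0; c, d] +
        !![1, 0; c, d] * (!![bm • b, 0; cp • (k + b * e), am • b] *
          !![(1 / bm) • e, (cm / bm) • 1;
            (-(cp / (am * bm))) • (e * e), (bp / am - cp * cm / (am * bm)) • e]) := by
  have hΔ' : 1 / bm' = bp - cp * cm / bm := by
    field_simp
    linear_combination -hΔ
  rw [Matrix.mul_fin_two, Matrix.mul_fin_two, Matrix.mul_fin_two, Matrix.mul_fin_two]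
  ext1 i j
  fin_cases i <;> fin_cases j <;>
    simp only [Fin.zero_eta, Fin.mk_one, Matrix.of_apply, Matrix.cons_val', Matrix.cons_val_zero,
      Matrix.cons_val_one, Matrix.cons_val_fin_one, smul_mul_assoc, mul_smul_comm, mul_one,
      one_mul, zero_mul, mul_zero, Matrix.add_apply, mul_add, add_mul, mul_assoc, smul_add,
      zero_add, add_zero, hK, ← hdk]
  -- The lower-left entry has used `hK`; the lower-right one, treated last, needs the determinant
  -- relation.
  · match_scalars <;> field_simp
  · match_scalars
    field_simp
  · match_scalars <;> field_simp <;> ring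
  · rw [hΔ']
    match_scalars <;> field_simp <;> ring

end Schur

/-! ### Reducing the twist to the tail of the chain -/

namespace Weights

variable {S : Type*} {W : Weights S}

/-- The matrix of the last step of the twist, in blocks with respect to the first space. -/
def twistStep (W : Weights S) (ξ : Fin (L + 1) → S) : Matrix (Fin 2) (Fin 2) (ChainOp (Fin L)) :=
  !![1, 0; W.twistedC (Fin.tail ξ) (ξ 0), W.twistedD (Fin.tail ξ) (ξ 0)]

theorem isUnit_twistStep {ξ : Fin (L + 1) → S}
    (hD : IsUnit (W.twistedD (Fin.tail ξ) (ξ 0))) : IsUnit (W.twistStep ξ) := by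
  obtain ⟨d, hd⟩ := hD
  refine ⟨⟨W.twistStep ξ,
    !![1, 0; -(↑d⁻¹ * W.twistedC (Fin.tail ξ) (ξ 0)), ↑d⁻¹], ?_, ?_⟩, rfl⟩ <;>
  · rw [twistStep, ← hd, Matrix.mul_fin_two]
    ext1 a b
    fin_cases a <;> fin_cases b <;> simp

section Step

variable {ξ : Fin (L + 1) → S} (hF : IsUnit (W.F (Fin.tail ξ)))
  (hDt : W.twist (Fin.tail ξ) (W.D (Fin.tail ξ) (ξ 0)) = W.twistedD (Fin.tail ξ) (ξ 0))
  (hCt : W.twist (Fin.tail ξ) (W.C (Fin.tail ξ) (ξ 0)) = W.twistedC (Fin.tail ξ) (ξ 0))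
include hF hDt hCt

theorem blocks_F :
    blocks L (W.F ξ) = W.twistStep ξ * !![W.F (Fin.tail ξ), 0; 0, W.F (Fin.tail ξ)] := by
  rw [F_succ, map_mul, blocks_liftTail, blocks_partialF_zero, twistStep, ← hDt, ← hCt,
    Matrix.mul_fin_two, Matrix.mul_fin_two]
  simp [twist_mul_F hF]

theorem isUnit_F_succ (hD : IsUnit (W.twistedD (Fin.tail ξ) (ξ 0))) : IsUnit (W.F ξ) := by
  rw [← MulEquiv.isUnit_map (blocks L), blocks_F hF hDt hCt, ← blocks_liftTail]
  exact (isUnit_twistStep hD).mul ((hF.map (liftTail L)).map (blocks L))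

/-- Conjugation by `F` factors into blockwise conjugation by the tail's `F` and conjugation by
`twistStep`. Written as an intertwining relation, it involves no inverse of the block matrix. -/
theorem blocks_twist_mul_twistStep (hD : IsUnit (W.twistedD (Fin.tail ξ) (ξ 0)))
    (X : ChainOp (Fin (L + 1))) :
    blocks L (W.twist ξ X) * W.twistStep ξ =
      W.twistStep ξ * (blocks L X).map (W.twist (Fin.tail ξ)) := by
  have h : ((blocks L X).map (W.twist (Fin.tail ξ))) * blocks L (liftTail L (W.F (Fin.tail ξ))) =
      blocks L (liftTail L (W.F (Fin.tail ξ))) * blocks L X := by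
    rw [blocks_liftTail]
    ext1 a b
    fin_cases b <;> fin_cases a <;> simp [Matrix.mul_apply, twist_mul_F hF]
  refine ((hF.map (liftTail L)).map (blocks L)).mul_right_cancel ?_
  rw [mul_assoc, mul_assoc, h, ← mul_assoc, ← mul_assoc, blocks_liftTail, mul_assoc,
    ← blocks_F hF hDt hCt, ← map_mul, ← map_mul, twist_mul_F (isUnit_F_succ hF hDt hCt hD)]

theorem twist_eq_of_blocks (hD : IsUnit (W.twistedD (Fin.tail ξ) (ξ 0)))
    {X Y : ChainOp (Fin (L + 1))}
    (h : W.twistStep ξ * (blocks L X).map (W.twist (Fin.tail ξ)) =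
      blocks L Y * W.twistStep ξ) : W.twist ξ X = Y := by
  apply (blocks L).injective
  refine (isUnit_twistStep hD).mul_right_cancel ?_
  rw [blocks_twist_mul_twistStep hF hDt hCt hD, h]

end Step

/-- The explicit form of the twisted operators, for a fixed chain. -/
structure TwistFormula (W : Weights S) (ξ : Fin L → S) : Prop where
  isUnit_F : IsUnit (W.F ξ)
  twist_D (μ : S) : W.twist ξ (W.D ξ μ) = W.twistedD ξ μ
  twist_C (μ : S) : W.twist ξ (W.C ξ μ) = W.twistedC ξ μ
  twist_B (μ : S) : W.twist ξ (W.B ξ μ) = W.twistedB ξ μ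
  twist_A (μ : S) (hμ : ∀ i, W.bm (ξ i) μ ≠ 0) (E : ChainOp (Fin L))
    (hE : W.twistedD ξ μ * E = W.twistedC ξ μ) :
    W.twist ξ (W.A ξ μ) = W.twistedSchur ξ μ + W.twistedB ξ μ * E

/-! ### Exchange relations and blocks after twisting the tail -/

namespace TwistFormula

section Relations

variable {ξ : Fin L → S} (h : W.TwistFormula ξ) (hYB : W.YangBaxter) (μ ν : S)
include h hYB

theorem C_mul_C :
    W.am μ ν • (W.twistedC ξ μ * W.twistedC ξ ν) = W.twistedC ξ ν * W.twistedC ξ μ := by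
  simpa only [twist_smul, twist_mul h.isUnit_F, h.twist_C] using
    congrArg (W.twist ξ) (hYB.C_mul_C ξ μ ν)

theorem D_mul_C :
    W.am μ ν • (W.twistedD ξ μ * W.twistedC ξ ν) =
      W.bm μ ν • (W.twistedC ξ ν * W.twistedD ξ μ) +
        W.cp μ ν • (W.twistedD ξ ν * W.twistedC ξ μ) := by
  simpa only [twist_add, twist_smul, twist_mul h.isUnit_F, h.twist_C, h.twist_D] using
    congrArg (W.twist ξ) (hYB.D_mul_C ξ μ ν)

theorem C_mul_D :
    W.am μ ν • (W.twistedC ξ μ * W.twistedD ξ ν) =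
      W.cm μ ν • (W.twistedC ξ ν * W.twistedD ξ μ) +
        W.bp μ ν • (W.twistedD ξ ν * W.twistedC ξ μ) := by
  simpa only [twist_add, twist_smul, twist_mul h.isUnit_F, h.twist_C, h.twist_D] using
    congrArg (W.twist ξ) (hYB.C_mul_D ξ μ ν)

theorem D_mul_B :
    W.am μ ν • (W.twistedD ξ ν * W.twistedB ξ μ) =
      W.bp μ ν • (W.twistedB ξ μ * W.twistedD ξ ν) +
        W.cp μ ν • (W.twistedD ξ μ * W.twistedB ξ ν) := by
  simpa only [twist_add, twist_smul, twist_mul h.isUnit_F, h.twist_B, h.twist_D] using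
    congrArg (W.twist ξ) (hYB.D_mul_B ξ μ ν)

theorem B_mul_C :
    W.bp μ ν • (W.twistedB ξ μ * W.twistedC ξ ν) +
        W.cp μ ν • (W.twistedD ξ μ * W.twist ξ (W.A ξ ν)) =
      W.bm μ ν • (W.twistedC ξ ν * W.twistedB ξ μ) +
        W.cp μ ν • (W.twistedD ξ ν * W.twist ξ (W.A ξ μ)) := by
  simpa only [twist_add, twist_smul, twist_mul h.isUnit_F, h.twist_B, h.twist_C, h.twist_D] using
    congrArg (W.twist ξ) (hYB.B_mul_C ξ μ ν)

end Relations

section MapBlocks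

variable {ξ : Fin (L + 1) → S} (h : W.TwistFormula (Fin.tail ξ)) (μ : S)
include h

theorem map_blocks_D :
    (blocks L (W.D ξ μ)).map (W.twist (Fin.tail ξ)) =
      !![W.bm μ (ξ 0) • W.twistedD (Fin.tail ξ) μ, 0;
         W.cp μ (ξ 0) • W.twistedC (Fin.tail ξ) μ, W.am μ (ξ 0) • W.twistedD (Fin.tail ξ) μ] := by
  rw [blocks_D]
  ext1 a b
  fin_cases a <;> fin_cases b <;> simp [twist_smul, twist_zero, h.twist_D, h.twist_C]

theorem map_blocks_C :
    (blocks L (W.C ξ μ)).map (W.twist (Fin.tail ξ)) =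
      !![W.twistedC (Fin.tail ξ) μ, W.cm μ (ξ 0) • W.twistedD (Fin.tail ξ) μ;
         0, W.bp μ (ξ 0) • W.twistedC (Fin.tail ξ) μ] := by
  rw [blocks_C]
  ext1 a b
  fin_cases a <;> fin_cases b <;> simp [twist_smul, twist_zero, h.twist_D, h.twist_C]

theorem map_blocks_B :
    (blocks L (W.B ξ μ)).map (W.twist (Fin.tail ξ)) =
      !![W.bm μ (ξ 0) • W.twistedB (Fin.tail ξ) μ, 0;
         W.cp μ (ξ 0) • W.twist (Fin.tail ξ) (W.A (Fin.tail ξ) μ),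
         W.am μ (ξ 0) • W.twistedB (Fin.tail ξ) μ] := by
  rw [blocks_B]
  ext1 a b
  fin_cases a <;> fin_cases b <;> simp [twist_smul, twist_zero, h.twist_B]

theorem map_blocks_A :
    (blocks L (W.A ξ μ)).map (W.twist (Fin.tail ξ)) =
      !![W.twist (Fin.tail ξ) (W.A (Fin.tail ξ) μ), W.cm μ (ξ 0) • W.twistedB (Fin.tail ξ) μ;
         0, W.bp μ (ξ 0) • W.twist (Fin.tail ξ) (W.A (Fin.tail ξ) μ)] := by
  rw [blocks_A]
  ext1 a b
  fin_cases a <;> fin_cases b <;> simp [twist_smul, twist_zero, h.twist_B]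

end MapBlocks

/-! ### Inductive step for the four operators -/

section Succ

variable {ξ : Fin (L + 1) → S} (h : W.TwistFormula (Fin.tail ξ))
  (hU : W.Unitarity) (hYB : W.YangBaxter)
  (hξ : ∀ i j : Fin (L + 1), i ≠ j → W.bm (ξ i) (ξ j) ≠ 0)
include h hU hYB hξ

omit h hYB in
theorem isUnit_twistedD_tail : IsUnit (W.twistedD (Fin.tail ξ) (ξ 0)) :=
  isUnit_twistedD _ hU fun i => hξ 0 i.succ (Fin.succ_ne_zero i).symm

omit hYB in
theorem twist_eq_of_blocks_succ {X Y : ChainOp (Fin (L + 1))}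
    (hXY : W.twistStep ξ * (blocks L X).map (W.twist (Fin.tail ξ)) =
      blocks L Y * W.twistStep ξ) : W.twist ξ X = Y :=
  twist_eq_of_blocks h.isUnit_F (h.twist_D _) (h.twist_C _) (isUnit_twistedD_tail hU hξ) hXY

theorem twist_D_succ (μ : S) : W.twist ξ (W.D ξ μ) = W.twistedD ξ μ := by
  refine h.twist_eq_of_blocks_succ hU hξ ?_
  have h1 := h.D_mul_C hYB μ (ξ 0)
  rw [h.map_blocks_D, blocks_twistedD, twistStep]
  ext1 a b
  fin_cases a <;> fin_cases b <;>
    simp [Matrix.mul_apply, h1,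
      twistedD_commute_twistedD (Fin.tail ξ) (μ := ξ 0) (ν := μ)]

theorem twist_C_succ (μ : S) : W.twist ξ (W.C ξ μ) = W.twistedC ξ μ := by
  have hb : ∀ i, W.bm (ξ 0) (Fin.tail ξ i) ≠ 0 := fun i => hξ 0 i.succ (Fin.succ_ne_zero i).symm
  have hb' : ∀ i, W.bm (Fin.tail ξ i) (ξ 0) ≠ 0 := fun i => hξ i.succ 0 (Fin.succ_ne_zero i)
  refine h.twist_eq_of_blocks_succ hU hξ ?_
  have h1 := h.C_mul_D hYB μ (ξ 0)
  have h2 := h.C_mul_C hYB μ (ξ 0)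
  -- This is the upper-left block identity, the only one for `C̃` that compares coefficients tensor
  -- by tensor.
  have h3 : W.twistedC (Fin.tail ξ) μ =
      ∑ l, (W.cm μ (Fin.tail ξ l) * (W.bm μ (ξ 0) / W.bm (Fin.tail ξ l) (ξ 0))) •
          W.twistedCTerm (Fin.tail ξ) μ l +
        W.cm μ (ξ 0) •
          (W.twistedDRatio (Fin.tail ξ) μ (ξ 0) * W.twistedC (Fin.tail ξ) (ξ 0)) := by
    rw [twistedDRatio_mul_twistedC _ hU hb, Finset.smul_sum, ← Finset.sum_add_distrib, twistedC]
    refine Finset.sum_congr rfl fun l _ => ?_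
    rw [smul_smul, ← add_smul]
    congr 1
    -- Unitarity turns `c₋(ξ₀,ξ_l)/b₋(ξ₀,ξ_l)` into `-c₊(ξ_l,ξ₀)/b₋(ξ_l,ξ₀)`; what remains is the
    -- Yang–Baxter identity `e1`.
    have e1 := hYB.bm_mul_cm μ (Fin.tail ξ l) (ξ 0)
    have e2 := hU.cm_mul_bm (ξ 0) (Fin.tail ξ l)
    have := hb l
    have := hb' l
    field_simp
    linear_combination (-W.bm (ξ 0) (Fin.tail ξ l)) * e1 -
      W.cm μ (ξ 0) * W.bm μ (Fin.tail ξ l) * e2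
  rw [h.map_blocks_C, blocks_twistedC, twistStep]
  ext1 a b
  fin_cases a <;> fin_cases b <;>
    simp [Matrix.mul_apply, h1, h2, ← h3,
      twistedDRatio_mul_twistedD _ hU hb]

theorem twist_B_succ (μ : S) : W.twist ξ (W.B ξ μ) = W.twistedB ξ μ := by
  have hb : ∀ i, W.bm (ξ 0) (Fin.tail ξ i) ≠ 0 := fun i => hξ 0 i.succ (Fin.succ_ne_zero i).symm
  have hb' : ∀ i, W.bm (Fin.tail ξ i) (ξ 0) ≠ 0 := fun i => hξ i.succ 0 (Fin.succ_ne_zero i)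
  -- `E` plays the role of `D̃(ξ₀)⁻¹ C̃(ξ₀)`, the form in which the induction hypothesis for `A`
  -- accepts it.
  obtain ⟨E, hE⟩ : ∃ E, W.twistedD (Fin.tail ξ) (ξ 0) * E = W.twistedC (Fin.tail ξ) (ξ 0) :=
    (isUnit_twistedD_tail hU hξ).dvd.imp fun _ => Eq.symm
  refine h.twist_eq_of_blocks_succ hU hξ ?_
  have h1 := h.B_mul_C hYB μ (ξ 0)
  have h2 := h.D_mul_B hYB μ (ξ 0)
  have hA := h.twist_A (ξ 0) hb' E hE
  have h3 : (∑ l, (W.cp μ (Fin.tail ξ l) *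
      (W.am (ξ 0) (Fin.tail ξ l) / W.bm (ξ 0) (Fin.tail ξ l))) •
        W.twistedBTerm (Fin.tail ξ) μ l) * W.twistedD (Fin.tail ξ) (ξ 0) =
      W.twistedD (Fin.tail ξ) (ξ 0) * W.twistedB (Fin.tail ξ) μ := by
    simp only [twistedB, Finset.mul_sum, mul_smul_comm, twistedD_mul_twistedBTerm _ hb,
      Finset.sum_mul, smul_mul_assoc, smul_smul]
  -- The D–B exchange relation multiplied on the right by `E`, which turns its trailing `D̃(ξ₀)`
  -- into `C̃(ξ₀)`.
  have h4 : W.am μ (ξ 0) • ((∑ l, (W.cp μ (Fin.tail ξ l) *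
      (W.am (ξ 0) (Fin.tail ξ l) / W.bm (ξ 0) (Fin.tail ξ l))) •
        W.twistedBTerm (Fin.tail ξ) μ l) * W.twistedC (Fin.tail ξ) (ξ 0)) =
      W.bp μ (ξ 0) • (W.twistedB (Fin.tail ξ) μ * W.twistedC (Fin.tail ξ) (ξ 0)) +
        W.cp μ (ξ 0) • (W.twistedD (Fin.tail ξ) μ * (W.twistedB (Fin.tail ξ) (ξ 0) * E)) := by
    rw [← h3] at h2
    simpa only [add_mul, smul_mul_assoc, mul_assoc, hE] using congrArg (· * E) h2
  rw [hA] at h1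
  rw [h.map_blocks_B, blocks_twistedB, twistStep]
  ext1 a b
  fin_cases a <;> fin_cases b
  · simp [Matrix.mul_apply]
  · simp [Matrix.mul_apply]
  · simp only [mul_add] at h1
    simp [Matrix.mul_apply, h4]
    linear_combination (norm := module) -h1
  · simp [Matrix.mul_apply, h3]

-- Both sides expand in the same elementary tensors, since moving the diagonal factors past a term
-- of `C̃` only rescales it. This supplies the hypothesis `hK` of `block_schur`.
omit h hξ in
theorem twistedSchur_mul_twistedC (μ : S) (hμ : ∀ i, W.bm (ξ i) μ ≠ 0) :
    (1 / W.bm (ξ 0) μ) • (W.twistedSchur (Fin.tail ξ) μ * W.twistedC (Fin.tail ξ) (ξ 0)) =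
      W.twistedC (Fin.tail ξ) (ξ 0) * W.twistedSchur (Fin.tail ξ) μ -
        (W.cp μ (ξ 0) / W.bm μ (ξ 0)) • (W.twistedSchur (Fin.tail ξ) μ *
          (W.twistedDRatio (Fin.tail ξ) (ξ 0) μ * W.twistedC (Fin.tail ξ) μ)) := by
  have hb : ∀ i, W.bm μ (ξ i) ≠ 0 := fun i => hU.bm_ne_zero (hμ i)
  rw [twistedDRatio_mul_twistedC (Fin.tail ξ) hU fun i => hb i.succ, eq_sub_iff_add_eq]
  simp only [twistedC, Finset.mul_sum, Finset.sum_mul, Finset.smul_sum, mul_smul_comm,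
    smul_mul_assoc, twistedCTerm_mul_twistedSchur, smul_smul]
  rw [← Finset.sum_add_distrib]
  refine Finset.sum_congr rfl fun l _ => ?_
  rw [← add_smul]
  congr 1
  have e1 := hYB.bm_mul_cm (ξ 0) (Fin.tail ξ l) μ
  have e2 := hU.cm_mul_bm (ξ 0) μ
  have e3 := hU.cm_mul_bm μ (Fin.tail ξ l)
  have := hμ 0
  have := hb 0
  have : W.bm (Fin.tail ξ l) μ ≠ 0 := hμ l.succ
  have : W.bm μ (Fin.tail ξ l) ≠ 0 := hb l.succ
  field_simp
  linear_combination (-W.bm μ (ξ 0) * W.bm μ (Fin.tail ξ l)) * e1 +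
    W.bm (ξ 0) (Fin.tail ξ l) * (W.cm μ (Fin.tail ξ l) * W.bm (Fin.tail ξ l) μ * e2 -
      W.cm (ξ 0) μ * W.bm μ (ξ 0) * e3)

theorem twist_A_succ (μ : S) (hμ : ∀ i, W.bm (ξ i) μ ≠ 0) (E : ChainOp (Fin (L + 1)))
    (hE : W.twistedD ξ μ * E = W.twistedC ξ μ) :
    W.twist ξ (W.A ξ μ) = W.twistedSchur ξ μ + W.twistedB ξ μ * E := by
  have hb : ∀ i, W.bm μ (ξ i) ≠ 0 := fun i => hU.bm_ne_zero (hμ i)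
  have hb0 := hb 0
  have ha0 := hU.am_ne_zero μ (ξ 0)
  have hb0' := hμ 0
  have hΔ := hU.bm_mul_det μ (ξ 0)
  obtain ⟨e, he⟩ : ∃ e, W.twistedD (Fin.tail ξ) μ * e = W.twistedC (Fin.tail ξ) μ :=
    (isUnit_twistedD (Fin.tail ξ) hU fun i => hb i.succ).dvd.imp fun _ => Eq.symm
  have hA := h.twist_A μ (fun i => hμ i.succ) e he
  have hstep := blocks_twist_mul_twistStep h.isUnit_F (h.twist_D _) (h.twist_C _)
    (isUnit_twistedD_tail hU hξ)
  have hratio : W.twistedDRatio (Fin.tail ξ) (ξ 0) μ * W.twistedC (Fin.tail ξ) μ =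
      W.twistedD (Fin.tail ξ) (ξ 0) * e := by
    rw [← he, ← mul_assoc, twistedDRatio_mul_twistedD (Fin.tail ξ) hU fun i => hb i.succ]
  have hK := twistedSchur_mul_twistedC hU hYB μ hμ
  rw [hratio, ← mul_assoc, ← twistedD_commute_twistedSchur, mul_assoc] at hK
  have hE' : blocks L E * W.twistStep ξ = W.twistStep ξ *
      !![(1 / W.bm μ (ξ 0)) • e, (W.cm μ (ξ 0) / W.bm μ (ξ 0)) • 1;
        (-(W.cp μ (ξ 0) / (W.am μ (ξ 0) * W.bm μ (ξ 0)))) • (e * e),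
        (W.bp μ (ξ 0) / W.am μ (ξ 0) -
          W.cp μ (ξ 0) * W.cm μ (ξ 0) / (W.am μ (ξ 0) * W.bm μ (ξ 0))) • e] := by
    -- Since `D̃(μ)` is a unit, `E` is determined by `D̃ E = C̃`; undoing the `twistStep`
    -- conjugation turns this into the triangular system solved by `block_system`.
    refine ((isUnit_twistedD ξ hU hb).map (blocks L)).mul_left_cancel ?_
    rw [← mul_assoc, ← mul_assoc, ← map_mul, hE, ← h.twist_C_succ hU hYB hξ,
      ← h.twist_D_succ hU hYB hξ, hstep, hstep, mul_assoc, h.map_blocks_D, h.map_blocks_C,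
      block_system ha0 hb0 he]
  refine h.twist_eq_of_blocks_succ hU hξ ?_
  rw [map_add, add_mul, map_mul, mul_assoc, hE', ← mul_assoc, ← h.twist_B_succ hU hYB hξ, hstep,
    mul_assoc, h.map_blocks_A, h.map_blocks_B, blocks_twistedSchur, twistStep, hA]
  exact block_schur ha0 hb0 hb0' hΔ (twistedD_commute_twistedSchur _) hK

end Succ

end TwistFormula

/-! ### The induction -/

theorem twistFormula_zero (ξ : Fin 0 → S) : W.TwistFormula ξ where
  isUnit_F := by rw [F_zero]; exact isUnit_one
  twist_D μ := by
    ext u v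
    simp [twist, F_zero, D, entry, monodromy, Rleft, twistedD, tensorOp, Matrix.one_apply,
      Subsingleton.elim u v]
  twist_C μ := by
    ext u v
    simp [twist, F_zero, C, entry, monodromy, Rleft, twistedC]
  twist_B μ := by
    ext u v
    simp [twist, F_zero, B, entry, monodromy, Rleft, twistedB]
  twist_A μ _ E _ := by
    ext u v
    simp [twist, F_zero, A, entry, monodromy, Rleft, twistedB, twistedSchur, tensorOp,
      Matrix.one_apply, Subsingleton.elim u v]

theorem twistFormula (hU : W.Unitarity) (hYB : W.YangBaxter) : ∀ {L : ℕ} (ξ : Fin L → S)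
    (_ : ∀ i j : Fin L, i ≠ j → W.bm (ξ i) (ξ j) ≠ 0), W.TwistFormula ξ
  | 0, ξ, _ => twistFormula_zero ξ
  | L + 1, ξ, hξ => by
    have h : W.TwistFormula (Fin.tail ξ) := twistFormula hU hYB (Fin.tail ξ)
      fun i j hij => hξ i.succ j.succ ((Fin.succ_injective L).ne hij)
    exact {
      isUnit_F := isUnit_F_succ h.isUnit_F (h.twist_D _) (h.twist_C _)
        (TwistFormula.isUnit_twistedD_tail hU hξ)
      twist_D := h.twist_D_succ hU hYB hξ
      twist_C := h.twist_C_succ hU hYB hξ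
      twist_B := h.twist_B_succ hU hYB hξ
      twist_A := h.twist_A_succ hU hYB hξ }

/-! ### Lower triangularity -/

theorem toLex_cons_lt_toLex_cons {L : ℕ} {a b : Fin 2} {u v : Fin L → Fin 2}
    (h : toLex (Fin.cons a u : Fin (L + 1) → Fin 2) < toLex (Fin.cons b v)) :
    a < b ∨ a = b ∧ toLex u < toLex v := by
  obtain ⟨i, hi, hlt⟩ := h
  induction i using Fin.cases with
  | zero => exact Or.inl hlt
  | succ i =>
    exact Or.inr ⟨hi 0 (Fin.succ_pos i), i, fun j hj => hi j.succ (Fin.succ_lt_succ_iff.2 hj), hlt⟩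

/-- The first site is the most significant in the lexicographic order, so the zero upper-right block
and triangular diagonal blocks suffice. These are `F` of the tail and a diagonal matrix times it. -/
theorem F_lowerTriangular (hU : W.Unitarity) (hYB : W.YangBaxter) : ∀ {L : ℕ} (ξ : Fin L → S)
    (_ : ∀ i j : Fin L, i ≠ j → W.bm (ξ i) (ξ j) ≠ 0) (s t : Fin L → Fin 2),
    toLex s < toLex t → W.F ξ s t = 0
  | 0, _, _, s, t, hst => absurd hst (by rw [Subsingleton.elim s t]; exact lt_irrefl _)
  | L + 1, ξ, hξ, s, t, hst => by
    have hξ' : ∀ i j : Fin L, i ≠ j → W.bm (Fin.tail ξ i) (Fin.tail ξ j) ≠ 0 :=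
      fun i j hij => hξ i.succ j.succ ((Fin.succ_injective L).ne hij)
    have h := twistFormula hU hYB (Fin.tail ξ) hξ'
    have ih := F_lowerTriangular hU hYB (Fin.tail ξ) hξ'
    have hb := blocks_F h.isUnit_F (h.twist_D _) (h.twist_C _)
    rw [twistStep, Matrix.mul_fin_two] at hb
    have key : ∀ (a b : Fin 2) (u v : Fin L → Fin 2),
        toLex (Fin.cons a u : Fin (L + 1) → Fin 2) < toLex (Fin.cons b v) →
          blocks L (W.F ξ) a b u v = 0 := by
      intro a b u v hlt
      rw [hb]
      rcases toLex_cons_lt_toLex_cons hlt with hab | ⟨rfl, huv⟩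
      · obtain ⟨rfl, rfl⟩ : a = 0 ∧ b = 1 := by omega
        simp
      · fin_cases a
        · simp [ih _ _ huv]
        · simp [twistedD, tensorOp_diag, Matrix.diagonal_mul, ih _ _ huv]
    rw [← Fin.cons_self_tail s, ← Fin.cons_self_tail t] at hst
    simpa only [blocks_apply, Fin.cons_self_tail] using key _ _ _ _ hst

end Weights

end

end SixVertex
theorem mainTheorem1 {S : Type*} (W : SixVertex.Weights S)
    (hU : W.Unitarity) (hYB : W.YangBaxter)
    (L : ℕ) (ξ : Fin L → S)
    (hξ : ∀ i j : Fin L, i ≠ j → W.bm (ξ i) (ξ j) ≠ 0) :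
    -- `𝓕` is lower triangular and invertible
    (∀ s t : Fin L → Fin 2, toLex s < toLex t → W.F ξ s t = 0) ∧
    IsUnit (W.F ξ) ∧
    ∀ μ : S,
      -- the operator `D̃`
      W.twist ξ (W.D ξ μ) =
        SixVertex.tensorOp (fun i => !![W.bm μ (ξ i), 0; 0, W.am μ (ξ i)]) ∧
      -- the operator `C̃`
      W.twist ξ (W.C ξ μ) =
        ∑ l : Fin L, W.cm μ (ξ l) • SixVertex.tensorOp (fun i =>
          if i < l then
            !![W.bm μ (ξ i) / W.bm (ξ l) (ξ i), 0; 0, W.am μ (ξ i)]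
          else if i = l then SixVertex.e12
          else
            !![W.bm μ (ξ i) / W.bm (ξ l) (ξ i), 0; 0, W.am μ (ξ i) / W.am (ξ l) (ξ i)]) ∧
      -- the operator `B̃`
      W.twist ξ (W.B ξ μ) =
        ∑ l : Fin L, W.cp μ (ξ l) • SixVertex.tensorOp (fun i =>
          if i < l then
            !![W.bm μ (ξ i), 0; 0, W.am μ (ξ i) * W.am (ξ i) (ξ l) / W.bm (ξ i) (ξ l)]
          else if i = l then SixVertex.e21
          else
            !![W.bm μ (ξ i), 0; 0, W.am μ (ξ i) / W.bm (ξ i) (ξ l)]) ∧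
      -- the operator `Ã`, where the denominators `b₋(ξ_i, μ)` have to be nonzero
      ((∀ i : Fin L, W.bm (ξ i) μ ≠ 0) →
        IsUnit (W.twist ξ (W.D ξ μ)) ∧
        W.twist ξ (W.A ξ μ) =
          SixVertex.tensorOp (fun i => !![1, 0; 0, 1 / W.bm (ξ i) μ]) +
            W.twist ξ (W.B ξ μ) * (W.twist ξ (W.D ξ μ))⁻¹ * W.twist ξ (W.C ξ μ)) := by
  have h := SixVertex.Weights.twistFormula hU hYB ξ hξ
  refine ⟨SixVertex.Weights.F_lowerTriangular hU hYB ξ hξ, h.isUnit_F, fun μ =>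
    ⟨h.twist_D μ, h.twist_C μ, h.twist_B μ, fun hμ => ?_⟩⟩
  have hD : IsUnit (W.twistedD ξ μ) :=
    SixVertex.Weights.isUnit_twistedD ξ hU fun i => hU.bm_ne_zero (hμ i)
  rw [h.twist_B, h.twist_C, h.twist_D, mul_assoc]
  refine ⟨hD, h.twist_A μ hμ _ ?_⟩
  rw [← mul_assoc, Matrix.mul_nonsing_inv _ ((Matrix.isUnit_iff_isUnit_det _).1 hD), one_mul]
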